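/- Let $G$ be a countable group and let $A$ be a subgroup of $G$. A *mean* on $G$ is a finitely additive probability measure defined on all subsets of $G$; it is *diffuse* if its value on each finite subset of $G$ is zero. Suppose that: (1) each diffuse mean $m$ on $G$ which is invariant under conjugation by elements of $G$ is supported on $A$, i.e., satisfies $m(A)=1$; (2) the pair $(G,A)$ has property (T), i.e., every unitary representation of $G$ on a complex Hilbert space which has almost invariant vectors has a nonzero $A$-invariant vector. Then $G$ is not stable, i.e., there is no essentially free, ergodic, measure-preserving Borel action of $G$ on a standard probability space $(X,\mu)$ whose orbit equivalence relation $\mathcal{R}$ satisfies $\mathcal{R}\times\mathcal{R}_0\cong\mathcal{R}$ (isomorphism up to null sets). Here $\mathcal{R}_0$ denotes the ergodic probability-measure-preserving hyperfinite equivalence relation on an atomless standard probability space, which is unique up to isomorphism and is realized by the relation on $\{0,1\}^{\mathbb{N}}$, with the fair coin-tossing measure, of differing in only finitely many coordinates. -/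

import Mathlib

open MeasureTheory

universe u v

namespace StableGroup

/-- A mean on `G`: a finitely additive probability measure defined on all subsets of `G`. -/
structure IsMean {G : Type u} (m : Set G → ℝ) : Prop where
  nonneg : ∀ s, 0 ≤ m s
  univ : m Set.univ = 1
  union : ∀ s t, Disjoint s t → m (s ∪ t) = m s + m t

/-- A mean is diffuse if its value on each finite subset is zero. -/
def IsDiffuse {G : Type u} (m : Set G → ℝ) : Prop :=
  ∀ s : Set G, s.Finite → m s = 0

/-- Invariance under the conjugation action of `G` on itself. -/
def IsConjInvariant {G : Type u} [Group G] (m : Set G → ℝ) : Prop :=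
  ∀ (g : G) (s : Set G), m ((fun x => g * x * g⁻¹) '' s) = m s

/-- A unitary representation of the discrete group `G` has almost invariant vectors (equivalently,
it weakly contains the trivial representation). -/
def HasAlmostInvariantVectors {G : Type u} [Group G] {H : Type v} [NormedAddCommGroup H]
    [InnerProductSpace ℂ H] (π : G →* (H ≃ₗᵢ[ℂ] H)) : Prop :=
  ∀ (F : Finset G) (ε : ℝ), 0 < ε → ∃ ξ : H, ‖ξ‖ = 1 ∧ ∀ g ∈ F, ‖π g ξ - ξ‖ < ε

/-- The pair `(G, A)` has property (T): every unitary representation of `G` on a complex Hilbert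
space which has almost invariant vectors has a nonzero `A`-invariant vector. -/
def PairHasPropertyT {G : Type u} [Group G] (A : Subgroup G) : Prop :=
  ∀ (H : Type u) [NormedAddCommGroup H] [InnerProductSpace ℂ H] [CompleteSpace H]
    (π : G →* (H ≃ₗᵢ[ℂ] H)), HasAlmostInvariantVectors π →
      ∃ η : H, η ≠ 0 ∧ ∀ a ∈ A, π a η = η

/-- Isomorphism, up to null sets, of equivalence relations on measure spaces: a measure-preserving
map `f`, invertible up to null sets with measure-preserving inverse, which carries one relation to
the other on a conull Borel set. -/
def PMPRelIso {X : Type u} {Y : Type v} [MeasurableSpace X] [MeasurableSpace Y]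
    (R : Setoid X) (μ : Measure X) (S : Setoid Y) (ν : Measure Y) : Prop :=
  ∃ (f : X → Y) (g : Y → X), MeasurePreserving f μ ν ∧ MeasurePreserving g ν μ ∧
    (∀ᵐ x ∂μ, g (f x) = x) ∧ (∀ᵐ y ∂ν, f (g y) = y) ∧
    ∃ X₀ : Set X, MeasurableSet X₀ ∧ μ X₀ᶜ = 0 ∧
      ∀ x ∈ X₀, ∀ x' ∈ X₀, (R x x' ↔ S (f x) (f x'))

/-- The fair coin-tossing measure on `{0,1}^ℕ`, i.e. the Haar measure of `∏_ℕ ℤ/2ℤ`. -/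
noncomputable def coinMeasure : Measure (ℕ → Bool) :=
  Measure.infinitePi fun _ => (PMF.uniformOfFintype Bool).toMeasure

/-- The ergodic p.m.p. hyperfinite equivalence relation on the atomless standard probability space
`({0,1}^ℕ, coinMeasure)`: two sequences are equivalent iff they differ in finitely many
coordinates. This is the orbit equivalence relation of the translation action of `⨁_ℕ ℤ/2ℤ`
on `∏_ℕ ℤ/2ℤ`. An ergodic p.m.p. hyperfinite equivalence relation on an atomless standard
probability space is unique up to isomorphism, so this is the standard model of it. -/
def hyperfiniteRel : Setoid (ℕ → Bool) where
  r x y := {n | x n ≠ y n}.Finite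
  iseqv :=
    { refl := fun x => by simp
      symm := fun {x y} h => by simpa only [ne_comm] using h
      trans := fun {x y z} h₁ h₂ => (h₁.union h₂).subset fun n hn => by
        by_contra hc
        simp only [Set.mem_union, Set.mem_ofPred_eq, not_or, not_not] at hc hn
        exact hn (hc.1.trans hc.2) }

/-- The action of `G` on `(X, μ)` is (essentially) free: the stabilizer of almost every point is
trivial. -/
def IsEssentiallyFree (G : Type u) [Group G] (X : Type v) [MeasurableSpace X] [MulAction G X]
    (μ : Measure X) : Prop :=
  ∀ᵐ x ∂μ, ∀ g : G, g • x = x → g = 1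

/-- The orbit equivalence relation `R` of the action of `G` on `(X, μ)` absorbs the ergodic
hyperfinite relation `R₀` under direct product: `R × R₀` is isomorphic to `R`. -/
def IsStableAction (G : Type u) [Group G] (X : Type v) [MeasurableSpace X] [MulAction G X]
    (μ : Measure X) : Prop :=
  PMPRelIso ((MulAction.orbitRel G X).prod hyperfiniteRel) (μ.prod coinMeasure)
    (MulAction.orbitRel G X) μ

/-- `G` is stable: it has a free ergodic probability-measure-preserving Borel action on a standard
probability space which is stable. (`ErgodicSMul` includes invariance of the measure.) -/
def IsStable (G : Type u) [Group G] : Prop :=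
  ∃ (X : Type u) (_ : MeasurableSpace X) (_ : StandardBorelSpace X) (_ : MulAction G X)
    (_ : MeasurableConstSMul G X) (μ : Measure X),
    IsProbabilityMeasure μ ∧ ErgodicSMul G X μ ∧ IsEssentiallyFree G X μ ∧ IsStableAction G X μ

end StableGroup

/-! # Groups with property (T) relative to a subgroup carrying all central means are not stable

Let `R` be the orbit relation of a free action of `G` on `(X, μ)`, and suppose `R × R₀ ≅ R`, with
`R₀` the finite-difference relation on `{0,1}^ℕ`. Pulling back the second factor gives a map
`c : X → {0,1}^ℕ` that sends `R`-related points to sequences with finitely many differences, and the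
flips of the `n`-th coordinate give maps `T n : X → X` with `T n x ∈ G • x`. Each measurable set is
asymptotically fixed by `T n` (`tendsto_measure_diff_flipCoords`), and `T n` asymptotically commutes
with `G` (`IsStableAction.exists_isCentralFlip`).

Write `T n x = u n x • x`, where `u n x ∈ G` is almost surely unique by freeness. Any limit along an
ultrafilter of the distributions of `u n` is a mean on `G`. It is conjugation-invariant because
`T n` is asymptotically central. It is diffuse: `u n x ≠ 1` because `T n` has no fixed points, and
for `g ≠ 1` the event `u n x = g` is unlikely because `g` displaces small sets, whereas `T n`
asymptotically fixes them (`IsCentralFlip.exists_mean`). By the hypothesis on means,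
`u n x ∈ A` for most `x`, along the ultrafilter.

On the other hand, the parity of the number of differences between `c (g • x)` and `c x` is a
`±1`-valued cocycle, and twisting the Koopman representation by it gives a unitary representation
of `G` on `L²(X, μ)`. The cocycle is a pointwise limit of coboundaries, so this representation has
almost invariant vectors (`hasAlmostInvariantVectors_parityRep`), hence by property (T) a nonzero
`A`-invariant vector `η`. As `T n` flips a single coordinate and moves most points within their
`A`-orbits, `η (T n x) = -η x` for most `x`. But `T n` asymptotically fixes the level sets of `η`,
so `η = 0` (`IsCentralFlip.eq_zero_of_parityRep_eq`), a contradiction.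
-/

namespace StableGroup

open Filter Topology
open scoped ENNReal

/-! ### Asymptotically invariant sets -/

section AsymptoticInvariance

variable {X : Type*} [MeasurableSpace X] {μ : Measure X} {ι : Type*}

theorem tendsto_measureReal_zero {s : ℕ → Set X} (h : Tendsto (fun n => μ (s n)) atTop (𝓝 0)) :
    Tendsto (fun n => μ.real (s n)) atTop (𝓝 0) :=
  (ENNReal.toReal_zero ▸ (ENNReal.continuousAt_toReal ENNReal.zero_ne_top).tendsto).comp h

/-- A sequence of maps which asymptotically fixes each of countably many sets asymptotically fixes
them simultaneously: for most points `x` of the union, `x` and `T n x` lie in a common `B i`. -/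
theorem tendsto_measure_iUnion_diff_iUnion_inter [IsFiniteMeasure μ] [Countable ι] {T : ℕ → X → X}
    {B : ι → Set X} (hB : ∀ i, MeasurableSet (B i))
    (h : ∀ i, Tendsto (fun n => μ (B i \ T n ⁻¹' B i)) atTop (𝓝 0)) :
    Tendsto (fun n => μ ((⋃ i, B i) \ ⋃ i, B i ∩ T n ⁻¹' B i)) atTop (𝓝 0) := by
  have hs : Tendsto (fun s : Finset ι => μ ((⋃ i, B i) \ ⋃ i ∈ s, B i)) atTop (𝓝 0) := by
    have h0 : μ (⋂ s : Finset ι, (⋃ i, B i) \ ⋃ i ∈ s, B i) = 0 := by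
      have : (⋂ s : Finset ι, (⋃ i, B i) \ ⋃ i ∈ s, B i) = ∅ := by
        ext x
        simp only [Set.mem_iInter, Set.mem_sdiff, Set.mem_iUnion, Set.mem_empty_iff_false,
          iff_false, not_forall]
        by_cases hx : ∃ i, x ∈ B i
        · obtain ⟨i, hi⟩ := hx
          exact ⟨{i}, fun hc => hc.2 ⟨i, Finset.mem_singleton_self i, hi⟩⟩
        · exact ⟨∅, fun hc => hx hc.1⟩
      rw [this, measure_empty]
    rw [← h0]
    refine tendsto_measure_iInter_atTop (fun s => ?_) (fun s t hst => ?_) ⟨∅, measure_ne_top _ _⟩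
    · exact ((MeasurableSet.iUnion hB).diff
        (Finset.measurableSet_biUnion s fun i _ => hB i)).nullMeasurableSet
    · exact Set.sdiff_subset_sdiff_right (Set.biUnion_subset_biUnion_left hst)
  rw [ENNReal.tendsto_nhds_zero]
  intro ε hε
  have hε2 : (0 : ℝ≥0∞) < ε / 2 := ENNReal.half_pos hε.ne'
  obtain ⟨s, hs⟩ := ((ENNReal.tendsto_nhds_zero.1 hs) _ hε2).exists
  have hsum : Tendsto (fun n => ∑ i ∈ s, μ (B i \ T n ⁻¹' B i)) atTop (𝓝 0) := by
    simpa using tendsto_finsetSum s fun i _ => h i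
  filter_upwards [(ENNReal.tendsto_nhds_zero.1 hsum) _ hε2] with n hn
  calc μ ((⋃ i, B i) \ ⋃ i, B i ∩ T n ⁻¹' B i)
      ≤ μ (((⋃ i, B i) \ ⋃ i ∈ s, B i) ∪ ⋃ i ∈ s, (B i \ T n ⁻¹' B i)) := by
        refine measure_mono fun x hx => ?_
        by_cases hxs : x ∈ ⋃ i ∈ s, B i
        · right
          simp only [Set.mem_iUnion, exists_prop] at hxs ⊢
          obtain ⟨i, his, hi⟩ := hxs
          exact ⟨i, his, hi, fun hT => hx.2 (Set.mem_iUnion.2 ⟨i, hi, hT⟩)⟩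
        · exact Or.inl ⟨hx.1, hxs⟩
    _ ≤ ε / 2 + ε / 2 := (measure_union_le _ _).trans
        (add_le_add hs ((measure_biUnion_finset_le _ _).trans hn))
    _ = ε := ENNReal.add_halves ε

/-- If countably many asymptotically fixed sets cover almost everything, then for most points `x`
the points `x` and `T n x` lie in a common member of the cover. -/
theorem tendsto_measure_not_exists_mem [IsFiniteMeasure μ] [Countable ι] {T : ℕ → X → X}
    {B : ι → Set X} (hB : ∀ i, MeasurableSet (B i))
    (h : ∀ i, Tendsto (fun n => μ (B i \ T n ⁻¹' B i)) atTop (𝓝 0))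
    (hcov : ∀ᵐ x ∂μ, ∃ i, x ∈ B i) :
    Tendsto (fun n => μ {x | ¬ ∃ i, x ∈ B i ∧ T n x ∈ B i}) atTop (𝓝 0) := by
  refine tendsto_of_tendsto_of_tendsto_of_le_of_le tendsto_const_nhds
    (tendsto_measure_iUnion_diff_iUnion_inter hB h) (fun _ => zero_le) fun n => ?_
  refine measure_mono_ae ?_
  filter_upwards [hcov] with x hx hx'
  exact ⟨Set.mem_iUnion.2 hx, fun hc => hx' (Set.mem_iUnion.1 hc)⟩

/-- The measurable sets `B` with `μ (B \ T n ⁻¹' B) → 0` form a σ-algebra. -/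
@[reducible]
def asymptoticallyInvariantSpace [IsFiniteMeasure μ] (T : ℕ → X → X)
    (hT : ∀ n, MeasurePreserving (T n) μ μ) : MeasurableSpace X where
  MeasurableSet' B := MeasurableSet B ∧ Tendsto (fun n => μ (B \ T n ⁻¹' B)) atTop (𝓝 0)
  measurableSet_empty := ⟨.empty, by simp⟩
  measurableSet_compl B hB := by
    refine ⟨hB.1.compl, hB.2.congr fun n => ?_⟩
    have h1 : Bᶜ \ T n ⁻¹' Bᶜ = T n ⁻¹' B \ B := by
      ext x; simp [and_comm]
    rw [h1]
    exact measure_sdiff_symm hB.1.nullMeasurableSet ((hT n).measurable hB.1).nullMeasurableSet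
      ((hT n).measure_preimage hB.1.nullMeasurableSet).symm (measure_ne_top _ _)
  measurableSet_iUnion B hB := by
    refine ⟨.iUnion fun i => (hB i).1, ?_⟩
    refine tendsto_of_tendsto_of_tendsto_of_le_of_le tendsto_const_nhds
      (tendsto_measure_iUnion_diff_iUnion_inter (fun i => (hB i).1) fun i => (hB i).2)
      (fun _ => zero_le) fun n => measure_mono (Set.sdiff_subset_sdiff_right ?_)
    exact Set.iUnion_subset fun i x hx => Set.mem_iUnion.2 ⟨i, hx.2⟩

end AsymptoticInvariance

/-! ### Coordinate flips on the Cantor space -/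

/-- The translation of `{0,1}^ℕ = ∏_ℕ ℤ/2ℤ` by the indicator function of a finite set. -/
def flipCoords (w : Finset ℕ) (c : ℕ → Bool) : ℕ → Bool := fun i => if i ∈ w then !(c i) else c i

theorem flipCoords_comm (w w' : Finset ℕ) (c : ℕ → Bool) :
    flipCoords w (flipCoords w' c) = flipCoords w' (flipCoords w c) := by
  ext i
  unfold flipCoords
  split_ifs <;> rfl

theorem setOf_flipCoords_ne (w : Finset ℕ) (c : ℕ → Bool) : {i | flipCoords w c i ≠ c i} = w := by
  ext i
  by_cases h : i ∈ w <;> simp [flipCoords, h]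

theorem exists_eq_flipCoords {c c' : ℕ → Bool} (h : {i | c i ≠ c' i}.Finite) :
    ∃ w, c = flipCoords w c' := by
  refine ⟨h.toFinset, ?_⟩
  ext i
  by_cases hi : c i = c' i
  · simp [flipCoords, hi]
  · simpa [flipCoords, hi] using Bool.eq_not_of_ne hi

@[fun_prop]
theorem measurable_flipCoords (w : Finset ℕ) : Measurable (flipCoords w) := by
  refine measurable_pi_lambda _ fun i => ?_
  by_cases h : i ∈ w
  · simpa [flipCoords, h, Function.comp_def] using
      (measurable_of_finite not).comp (measurable_pi_apply (X := fun _ : ℕ => Bool) i)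
  · simpa [flipCoords, h] using measurable_pi_apply i

instance : IsProbabilityMeasure coinMeasure := by
  unfold coinMeasure; infer_instance

theorem measurePreserving_flipCoords (w : Finset ℕ) :
    MeasurePreserving (flipCoords w) coinMeasure coinMeasure := by
  refine ⟨measurable_flipCoords w, ?_⟩
  have hnot : ((PMF.uniformOfFintype Bool).toMeasure).map not =
      (PMF.uniformOfFintype Bool).toMeasure := by
    refine Measure.ext_of_singleton fun b => ?_
    rw [Measure.map_apply (measurable_of_finite _) (.singleton _)]
    have : not ⁻¹' {b} = {!b} := by ext; simp [Bool.not_eq_eq_eq_not]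
    rw [this, PMF.toMeasure_apply_singleton _ _ (.singleton _),
      PMF.toMeasure_apply_singleton _ _ (.singleton _)]
    simp
  have := Measure.infinitePi_map_pi (fun _ : ℕ => (PMF.uniformOfFintype Bool).toMeasure)
    (f := fun i => if i ∈ w then not else id) (fun _ => measurable_of_finite _)
  have hf : (fun (x : ℕ → Bool) i => (if i ∈ w then not else id) (x i)) = flipCoords w := by
    ext x i
    by_cases h : i ∈ w <;> simp [flipCoords, h]
  rw [hf] at this
  refine this.trans ?_
  unfold coinMeasure
  congr 1
  ext1 i
  by_cases h : i ∈ w <;> simp [h, hnot]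

/-- Flipping the `n`-th coin asymptotically fixes each measurable set: the sets which are
asymptotically fixed form a σ-algebra, and sets depending on one coordinate are eventually
fixed. -/
theorem tendsto_measure_diff_flipCoords {X : Type*} [MeasurableSpace X] (μ : Measure X)
    [IsProbabilityMeasure μ] {B : Set (X × (ℕ → Bool))} (hB : MeasurableSet B) :
    Tendsto (fun n => (μ.prod coinMeasure) (B \ Prod.map id (flipCoords {n}) ⁻¹' B))
      atTop (𝓝 0) := by
  have hT : ∀ n, MeasurePreserving (Prod.map id (flipCoords {n}))
      (μ.prod coinMeasure) (μ.prod coinMeasure) := fun n =>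
    (MeasurePreserving.id μ).prod (measurePreserving_flipCoords {n})
  suffices h : (inferInstance : MeasurableSpace (X × (ℕ → Bool))) ≤
      asymptoticallyInvariantSpace _ hT from (h B hB).2
  refine sup_le ?_ ?_
  · rintro _ ⟨U, hU, rfl⟩
    refine ⟨measurable_fst hU, tendsto_const_nhds.congr fun n => ?_⟩
    simp [← Set.preimage_comp, Prod.map_fst']
  · have hpi : (MeasurableSpace.pi : MeasurableSpace (ℕ → Bool)) =
        ⨆ i, MeasurableSpace.comap (fun b : ℕ → Bool => b i) inferInstance := rfl
    refine (congrArg (MeasurableSpace.comap Prod.snd) hpi).trans_le ?_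
    rw [MeasurableSpace.comap_iSup]
    refine iSup_le fun i => ?_
    rw [MeasurableSpace.comap_comp]
    rintro _ ⟨U, hU, rfl⟩
    refine ⟨((measurable_pi_apply i).comp measurable_snd) hU,
      tendsto_const_nhds.congr' ?_⟩
    filter_upwards [eventually_ne_atTop i] with n hn
    have : ((fun b : ℕ → Bool => b i) ∘ Prod.snd) ∘ Prod.map id (flipCoords {n}) =
        ((fun b : ℕ → Bool => b i) ∘ (Prod.snd : X × (ℕ → Bool) → _)) := by
      ext x
      simp [flipCoords, hn.symm]
    rw [← Set.preimage_comp, this]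
    simp

/-! ### Central sequences of stable actions -/

/-- A sequence of maps `T n : X → X` which move points within their `G`-orbits, and asymptotically
fix each measurable set and commute with `G`, together with a homomorphism from the orbit relation
of `G` to `hyperfiniteRel` (given by the map `c`) under which `T n` becomes the flip of the `n`-th
coordinate. All conditions are up to null sets of `μ`. -/
structure IsCentralFlip (G : Type*) {X : Type*} [Group G] [MulAction G X] [MeasurableSpace X]
    (μ : Measure X) (c : X → ℕ → Bool) (T : ℕ → X → X) : Prop where
  measurable_coord : Measurable c
  measurable : ∀ n, Measurable (T n)
  finite_coord_ne : ∀ᵐ x ∂μ, ∀ g : G, {i | c (g • x) i ≠ c x i}.Finite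
  mem_orbit : ∀ n, ∀ᵐ x ∂μ, ∃ g : G, T n x = g • x
  coord_apply : ∀ n, ∀ᵐ x ∂μ, c (T n x) = flipCoords {n} (c x)
  tendsto_diff : ∀ B, MeasurableSet B → Tendsto (fun n => μ (B \ T n ⁻¹' B)) atTop (𝓝 0)
  tendsto_comm : ∀ g : G, Tendsto (fun n => μ {x | T n (g • x) ≠ g • T n x}) atTop (𝓝 0)

section Stable

variable {G : Type u} [Group G] [Countable G] {X : Type v} [MeasurableSpace X]
  [StandardBorelSpace X] [MulAction G X] [MeasurableConstSMul G X] {μ : Measure X}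
  [IsProbabilityMeasure μ] [SMulInvariantMeasure G X μ]

/-- The orbit relation `R` of a stable action has a central sequence: transport the flips of the
second factor through the isomorphism `R × R₀ ≅ R`. They are asymptotically central since an
element of `G` acts on `X × {0,1}^ℕ` by countably many pieces of maps `(x, c) ↦ (k • x, c + w)`,
which commute with the flips. -/
theorem IsStableAction.exists_isCentralFlip (h : IsStableAction G X μ) :
    ∃ (c : X → ℕ → Bool) (T : ℕ → X → X), IsCentralFlip G μ c T := by
  obtain ⟨f, e, hf, he, hef, hfe, Y₀, -, hY₀, hrel⟩ := h
  have hY₀' : ∀ᵐ y ∂μ.prod coinMeasure, y ∈ Y₀ := hY₀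
  set S : ℕ → X × (ℕ → Bool) → X × (ℕ → Bool) := fun n => Prod.map id (flipCoords {n}) with hS_def
  have hS : ∀ n, MeasurePreserving (S n) (μ.prod coinMeasure) (μ.prod coinMeasure) := fun n =>
    (MeasurePreserving.id μ).prod (measurePreserving_flipCoords {n})
  have hSe : ∀ n, MeasurePreserving (fun x => S n (e x)) μ (μ.prod coinMeasure) := fun n =>
    (hS n).comp he
  have heT : ∀ n, ∀ᵐ x ∂μ, e (f (S n (e x))) = S n (e x) := fun n =>
    (hSe n).quasiMeasurePreserving.ae hef
  have hT : ∀ n, Measurable fun x => f (S n (e x)) := fun n => hf.measurable.comp (hSe n).measurable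
  -- the isomorphism carries `x` and `g • x` to points related by `R × R₀`
  have hG : ∀ᵐ x ∂μ, ∀ g : G, (∃ k : G, (e (g • x)).1 = k • (e x).1) ∧
      {i | (e (g • x)).2 i ≠ (e x).2 i}.Finite := by
    have h1 : ∀ᵐ x ∂μ, ∀ g : G, e (g • x) ∈ Y₀ ∧ f (e (g • x)) = g • x := by
      rw [ae_all_iff]
      intro g
      exact (measurePreserving_smul g μ).quasiMeasurePreserving.ae
        ((he.quasiMeasurePreserving.ae hY₀').and hfe)
    filter_upwards [h1] with x hx g
    have hx1 := hx 1
    rw [one_smul] at hx1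
    have hR := (hrel _ (hx g).1 _ hx1.1).2 (by
      rw [(hx g).2, hx1.2]
      exact ⟨g, rfl⟩)
    obtain ⟨⟨k, hk⟩, hfin⟩ := hR
    exact ⟨⟨k, hk.symm⟩, hfin⟩
  have hdiff : ∀ B, MeasurableSet B →
      Tendsto (fun n => μ (B \ (fun x => f (S n (e x))) ⁻¹' B)) atTop (𝓝 0) := by
    intro B hB
    refine (tendsto_measure_diff_flipCoords μ (hf.measurable hB)).congr fun n => ?_
    rw [← he.measure_preimage ((hf.measurable hB).diff
      ((hS n).measurable (hf.measurable hB))).nullMeasurableSet]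
    refine measure_congr ?_
    filter_upwards [hfe] with x hx
    refine propext ?_
    change (f (e x) ∈ B ∧ ¬ f (S n (e x)) ∈ B) ↔ (x ∈ B ∧ ¬ f (S n (e x)) ∈ B)
    rw [hx]
  refine ⟨fun x => (e x).2, fun n x => f (S n (e x)), measurable_snd.comp he.measurable, hT, ?_, ?_,
    ?_, hdiff, ?_⟩
  · filter_upwards [hG] with x hx g using (hx g).2
  · intro n
    filter_upwards [hfe, he.quasiMeasurePreserving.ae hY₀',
      (hSe n).quasiMeasurePreserving.ae hY₀'] with x hx hx1 hx2
    have hR := (hrel _ hx2 _ hx1).1 ⟨⟨1, one_smul _ _⟩, by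
      change {i | flipCoords {n} (e x).2 i ≠ (e x).2 i}.Finite
      rw [setOf_flipCoords_ne]
      exact Finset.finite_toSet _⟩
    rw [hx] at hR
    obtain ⟨g, hg⟩ := hR
    exact ⟨g, hg.symm⟩
  · intro n
    filter_upwards [heT n] with x hx
    rw [hx]
    rfl
  · intro g
    -- the pieces on which `g` acts as `(x, c) ↦ (k • x, c + w)`
    let B : G × Finset ℕ → Set X := fun p =>
      {x | e (g • x) = (p.1 • (e x).1, flipCoords p.2 (e x).2)}
    have hB : ∀ p, MeasurableSet (B p) := fun p =>
      measurableSet_eq_fun (he.measurable.comp (measurable_const_smul g))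
        (((measurable_const_smul p.1).comp (measurable_fst.comp he.measurable)).prodMk
          ((measurable_flipCoords p.2).comp (measurable_snd.comp he.measurable)))
    have hcov : ∀ᵐ x ∂μ, ∃ p, x ∈ B p := by
      filter_upwards [hG] with x hx
      obtain ⟨⟨k, hk⟩, hfin⟩ := hx g
      obtain ⟨w, hw⟩ := exists_eq_flipCoords hfin
      exact ⟨(k, w), Prod.ext hk hw⟩
    refine tendsto_of_tendsto_of_tendsto_of_le_of_le tendsto_const_nhds
      (tendsto_measure_not_exists_mem hB (fun p => hdiff _ (hB p)) hcov) (fun _ => zero_le)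
      fun n => measure_mono_ae ?_
    filter_upwards [heT n, ((measurePreserving_smul g μ).comp
      (hf.comp (hSe n))).quasiMeasurePreserving.ae hfe] with x hx1 hx4
    -- where `x` and `T n x` lie in the same piece, `g` commutes with the flip
    rintro hne ⟨⟨k, w⟩, hp1, hp2⟩
    refine hne ?_
    have hp1' : e (g • x) = (k • (e x).1, flipCoords w (e x).2) := hp1
    have hp2' : e (g • f (S n (e x))) =
      (k • (e (f (S n (e x)))).1, flipCoords w (e (f (S n (e x)))).2) := hp2
    change f (S n (e (g • x))) = _
    rw [← show f (e (g • f (S n (e x)))) = g • f (S n (e x)) from hx4, hp2', hx1, hp1']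
    simp only [hS_def, Prod.map, id]
    rw [flipCoords_comm]

end Stable

/-! ### The conjugation-invariant mean of a central sequence -/

namespace IsCentralFlip

variable {G : Type u} [Group G] [Countable G] {X : Type v} [MeasurableSpace X]
  [StandardBorelSpace X] [MulAction G X] [MeasurableConstSMul G X] {μ : Measure X}
  [IsProbabilityMeasure μ] {c : X → ℕ → Bool} {T : ℕ → X → X}

omit [IsProbabilityMeasure μ] in
theorem measurableSet_exists_eq_smul (h : IsCentralFlip G μ c T) (n : ℕ) (s : Set G) :
    MeasurableSet {x | ∃ g ∈ s, T n x = g • x} := by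
  have : {x | ∃ g ∈ s, T n x = g • x} = ⋃ g ∈ s, {x | T n x = g • x} := by
    ext x; simp
  rw [this]
  exact .biUnion (Set.to_countable s) fun g _ =>
    measurableSet_eq_fun (h.measurable n) (measurable_const_smul g)

omit [Countable G] in
/-- By freeness, `X` is covered by countably many measurable sets disjoint from their image under
`g ≠ 1`, and `T n` asymptotically fixes these; `T n` itself has no fixed points. -/
theorem tendsto_measure_eq_smul (h : IsCentralFlip G μ c T) (hfree : IsEssentiallyFree G X μ)
    (g : G) : Tendsto (fun n => μ {x | T n x = g • x}) atTop (𝓝 0) := by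
  by_cases hg : g = 1
  · subst hg
    refine tendsto_const_nhds.congr fun n => Eq.symm ?_
    refine measure_eq_zero_iff_ae_notMem.2 ?_
    filter_upwards [h.coord_apply n] with x hx
    rintro (hTx : T n x = (1 : G) • x)
    rw [hTx, one_smul] at hx
    have := congrFun hx n
    simp [flipCoords] at this
  · obtain ⟨S, hS, hsep⟩ := exists_seq_separating X (p := MeasurableSet) MeasurableSet.univ Set.univ
    let V : ℕ × Bool → Set X := fun p => if p.2 then S p.1 else (S p.1)ᶜ
    have hV : ∀ p, MeasurableSet (V p) := by
      rintro ⟨n, _ | _⟩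
      · exact (hS n).compl
      · exact hS n
    have hVg : ∀ p, MeasurableSet (V p \ (g • ·) ⁻¹' V p) := fun p =>
      (hV p).diff (measurable_const_smul g (hV p))
    have hcov : ∀ᵐ x ∂μ, ∃ p, x ∈ V p \ (g • ·) ⁻¹' V p := by
      filter_upwards [hfree] with x hx
      by_contra! hc
      refine hg (hx g (hsep _ trivial _ trivial fun n => ⟨fun hn => ?_, fun hn => ?_⟩))
      · by_contra hxn
        exact hc (n, false) ⟨hxn, fun hgx => hgx hn⟩
      · by_contra hgx
        exact hc (n, true) ⟨hn, hgx⟩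
    refine tendsto_of_tendsto_of_tendsto_of_le_of_le tendsto_const_nhds
      (tendsto_measure_not_exists_mem hVg (fun p => h.tendsto_diff _ (hVg p)) hcov)
      (fun _ => zero_le) fun n => measure_mono ?_
    rintro x (hx : T n x = g • x) ⟨p, h1, h2⟩
    exact h1.2 (show g • x ∈ V p from hx ▸ h2.1)

/-- Write `T n x = u n x • x` with `u n x ∈ G`. The distributions of the random elements `u n` of
`G` accumulate at a diffuse conjugation-invariant mean on `G`. -/
theorem exists_mean [SMulInvariantMeasure G X μ] (h : IsCentralFlip G μ c T)
    (hfree : IsEssentiallyFree G X μ) :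
    ∃ m : Set G → ℝ, IsMean m ∧ IsDiffuse m ∧ IsConjInvariant m ∧
      ∀ s, Tendsto (fun n => μ.real {x | ∃ g ∈ s, T n x = g • x}) (hyperfilter ℕ) (𝓝 (m s)) := by
  have hlim : ∀ s : Set G, ∃ r : ℝ,
      Tendsto (fun n => μ.real {x | ∃ g ∈ s, T n x = g • x}) (hyperfilter ℕ) (𝓝 r) := fun s => by
    obtain ⟨r, -, hr⟩ := (isCompact_Icc (a := (0 : ℝ)) (b := 1)).ultrafilter_le_nhds
      ((hyperfilter ℕ).map fun n => μ.real {x | ∃ g ∈ s, T n x = g • x})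
      (le_principal_iff.2 (mem_map.2 (univ_mem' fun n => ⟨measureReal_nonneg, measureReal_le_one⟩)))
    exact ⟨r, hr⟩
  choose m hm using hlim
  have hle : (hyperfilter ℕ : Filter ℕ) ≤ atTop := Nat.hyperfilter_le_atTop
  refine ⟨m, ⟨fun s => ?_, ?_, fun s t hst => ?_⟩, fun s hs => ?_, fun g s => ?_, hm⟩
  · exact ge_of_tendsto' (hm s) fun n => measureReal_nonneg
  · refine tendsto_nhds_unique (hm _) (tendsto_const_nhds.congr fun n => ?_)
    have : {x | ∃ g ∈ (Set.univ : Set G), T n x = g • x} =ᵐ[μ] Set.univ := by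
      filter_upwards [h.mem_orbit n] with x hx
      obtain ⟨g, hg⟩ := hx
      exact propext ⟨fun _ => trivial, fun _ => ⟨g, trivial, hg⟩⟩
    rw [measureReal_congr this, probReal_univ]
  · refine tendsto_nhds_unique (hm _) (((hm s).add (hm t)).congr fun n => ?_)
    rw [← measureReal_union₀ (h.measurableSet_exists_eq_smul n t).nullMeasurableSet]
    · congr 1
      ext x
      simp only [Set.mem_union, Set.mem_ofPred_eq, or_and_right, exists_or]
    · refine measure_eq_zero_iff_ae_notMem.2 ?_
      filter_upwards [hfree] with x hx
      rintro ⟨⟨g, hg, hgx⟩, ⟨k, hk, hkx⟩⟩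
      have hgk : k⁻¹ * g = 1 := hx _ (by rw [mul_smul, ← hgx, hkx, inv_smul_smul])
      rw [inv_mul_eq_one] at hgk
      exact Set.disjoint_left.1 hst hg (hgk ▸ hk)
  · refine tendsto_nhds_unique (hm s) (Tendsto.mono_left ?_ hle)
    have hsum : Tendsto (fun n => ∑ g ∈ hs.toFinset, μ {x | T n x = g • x}) atTop (𝓝 0) := by
      simpa using tendsto_finsetSum hs.toFinset fun g _ => h.tendsto_measure_eq_smul hfree g
    refine tendsto_measureReal_zero
      (tendsto_of_tendsto_of_tendsto_of_le_of_le tendsto_const_nhds hsum (fun _ => zero_le)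
        fun n => ?_)
    refine le_trans (measure_mono ?_) (measure_biUnion_finset_le _ _)
    rintro x ⟨g, hg, hgx⟩
    exact Set.mem_biUnion (hs.mem_toFinset.2 hg) hgx
  · have h0 : Tendsto (fun n => μ.real {x | T n (g • x) ≠ g • T n x}) atTop (𝓝 0) :=
      tendsto_measureReal_zero (h.tendsto_comm g)
    refine sub_eq_zero.1 (tendsto_nhds_unique ((hm _).sub (hm s))
      (squeeze_zero_norm (fun n => ?_) (h0.mono_left hle)))
    -- conjugating `s` by `g` amounts to translating `x` by `g`, wherever `T n` and `g` commute
    have hms := h.measurableSet_exists_eq_smul n s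
    have hmc := h.measurableSet_exists_eq_smul n ((fun x => g * x * g⁻¹) '' s)
    rw [← (measurePreserving_smul g μ).measureReal_preimage hmc.nullMeasurableSet, Real.norm_eq_abs]
    refine (abs_measureReal_sub_le_measureReal_symmDiff
      (measurable_const_smul g hmc).nullMeasurableSet hms.nullMeasurableSet).trans
      (measureReal_mono ?_)
    intro x hx hc
    have hiff : x ∈ (g • ·) ⁻¹' {x | ∃ k ∈ (fun x => g * x * g⁻¹) '' s, T n x = k • x} ↔
        x ∈ {x | ∃ k ∈ s, T n x = k • x} := by
      simp only [Set.mem_preimage, Set.mem_ofPred_eq, Set.exists_mem_image, mul_smul, inv_smul_smul,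
        hc, smul_left_cancel_iff]
    rcases hx with hx | hx
    · exact hx.2 (hiff.1 hx.1)
    · exact hx.2 (hiff.2 hx.1)

end IsCentralFlip

/-! ### The parity cocycle of the hyperfinite relation -/

/-- The sign `±1` of a bit. -/
def bitSign (b : Bool) : ℂ := if b then -1 else 1

/-- The cocycle of `hyperfiniteRel` sending a pair of sequences to `-1` or `1` according to the
parity of the number of coordinates where they differ. (Junk value `1` off `hyperfiniteRel`.) -/
noncomputable def parity (a b : ℕ → Bool) : ℂ := ∏ᶠ i, bitSign (a i) * bitSign (b i)

@[simp]
theorem bitSign_mul_self (b : Bool) : bitSign b * bitSign b = 1 := by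
  cases b <;> simp [bitSign]

theorem norm_bitSign (b : Bool) : ‖bitSign b‖ = 1 := by
  cases b <;> simp [bitSign]

theorem mulSupport_bitSign_mul_bitSign (a b : ℕ → Bool) :
    (Function.mulSupport fun i => bitSign (a i) * bitSign (b i)) = {i | a i ≠ b i} := by
  ext i
  cases h : a i <;> cases h' : b i <;> simp [h, h', bitSign] <;> norm_num

theorem norm_parity (a b : ℕ → Bool) : ‖parity a b‖ = 1 :=
  finprod_induction (fun z : ℂ => ‖z‖ = 1) norm_one
    (fun x y hx hy => by rw [norm_mul, hx, hy, one_mul])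
    fun i => by rw [norm_mul, norm_bitSign, norm_bitSign, one_mul]

@[simp]
theorem parity_self (a : ℕ → Bool) : parity a a = 1 := by
  simp [parity]

theorem parity_mul_parity {a b c : ℕ → Bool} (hab : {i | a i ≠ b i}.Finite)
    (hbc : {i | b i ≠ c i}.Finite) : parity a b * parity b c = parity a c := by
  unfold parity
  rw [← finprod_mul_distrib]
  · refine finprod_congr fun i => ?_
    rw [mul_assoc, ← mul_assoc (bitSign (b i)), bitSign_mul_self, one_mul]
  · rwa [Function.HasFiniteMulSupport, mulSupport_bitSign_mul_bitSign]
  · rwa [Function.HasFiniteMulSupport, mulSupport_bitSign_mul_bitSign]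

theorem parity_flipCoords_singleton (n : ℕ) (a : ℕ → Bool) :
    parity (flipCoords {n} a) a = -1 := by
  unfold parity
  rw [finprod_eq_prod_of_mulSupport_subset _ (s := {n})
    (by rw [mulSupport_bitSign_mul_bitSign, setOf_flipCoords_ne])]
  cases h : a n <;> simp [flipCoords, bitSign, h]

/-- The product of the signs of the first `k` bits: a function whose coboundary agrees with `parity`
on pairs of sequences that agree from the `k`-th coordinate on. -/
noncomputable def signProd (k : ℕ) (a : ℕ → Bool) : ℂ := ∏ i ∈ Finset.range k, bitSign (a i)

theorem norm_signProd (k : ℕ) (a : ℕ → Bool) : ‖signProd k a‖ = 1 := by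
  simp [signProd, norm_prod, norm_bitSign]

theorem signProd_mul_self (k : ℕ) (a : ℕ → Bool) : signProd k a * signProd k a = 1 := by
  simp [signProd, ← Finset.prod_mul_distrib]

theorem parity_eq_signProd_mul {a b : ℕ → Bool} {k : ℕ} (h : ∀ i, k ≤ i → a i = b i) :
    parity a b = signProd k a * signProd k b := by
  unfold parity signProd
  rw [← Finset.prod_mul_distrib]
  refine finprod_eq_prod_of_mulSupport_subset _ ?_
  rw [mulSupport_bitSign_mul_bitSign]
  intro i hi
  by_contra hc
  exact hi (h i (by simpa using hc))

@[fun_prop]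
theorem measurable_signProd (k : ℕ) : Measurable (signProd k) :=
  Finset.measurable_fun_prod _ fun i _ =>
    (measurable_of_finite bitSign).comp (measurable_pi_apply (X := fun _ : ℕ => Bool) i)

theorem exists_forall_eq_of_finite {a b : ℕ → Bool} (h : {i | a i ≠ b i}.Finite) :
    ∃ k, ∀ i, k ≤ i → a i = b i := by
  obtain ⟨k, hk⟩ := h.bddAbove
  refine ⟨k + 1, fun i hi => ?_⟩
  by_contra hc
  exact absurd (hk hc) (by omega)

theorem aemeasurable_parity {X : Type*} [MeasurableSpace X] {μ : Measure X} {a b : X → ℕ → Bool}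
    (ha : Measurable a) (hb : Measurable b) (h : ∀ᵐ x ∂μ, {i | a x i ≠ b x i}.Finite) :
    AEMeasurable (fun x => parity (a x) (b x)) μ := by
  refine aemeasurable_of_tendsto_metrizable_ae'
    (f := fun k x => signProd k (a x) * signProd k (b x))
    (fun k => by fun_prop) ?_
  filter_upwards [h] with x hx
  obtain ⟨k, hk⟩ := exists_forall_eq_of_finite hx
  refine tendsto_const_nhds.congr' ?_
  filter_upwards [eventually_ge_atTop k] with l hl
  exact parity_eq_signProd_mul fun i hi => hk i (hl.trans hi)

/-! ### The parity representation -/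

section Representation

variable {G : Type u} [Group G] {X : Type v} [MeasurableSpace X] [MulAction G X]
  [MeasurableConstSMul G X] {μ : Measure X} [SMulInvariantMeasure G X μ] {c : X → ℕ → Bool}

theorem memLp_parity_mul (hc : Measurable c)
    (hfin : ∀ᵐ x ∂μ, ∀ g : G, {i | c (g • x) i ≠ c x i}.Finite) (g : G) (F : Lp ℂ 2 μ) :
    MemLp (fun x => parity (c x) (c (g⁻¹ • x)) * F (g⁻¹ • x)) 2 μ := by
  have hF : MemLp (fun x => F (g⁻¹ • x)) 2 μ :=
    (Lp.memLp F).comp_measurePreserving (measurePreserving_smul g⁻¹ μ)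
  refine hF.congr_norm ?_ (Eventually.of_forall fun x => ?_)
  · refine AEStronglyMeasurable.mul (AEMeasurable.aestronglyMeasurable ?_) hF.1
    refine aemeasurable_parity hc (hc.comp (measurable_const_smul g⁻¹)) ?_
    filter_upwards [hfin] with x hx
    simpa only [ne_comm] using hx g⁻¹
  · rw [norm_mul, norm_parity, one_mul]

/-- The operator of the parity representation: translation by `g` twisted by the parity cocycle. -/
noncomputable def parityOp (hc : Measurable c)
    (hfin : ∀ᵐ x ∂μ, ∀ g : G, {i | c (g • x) i ≠ c x i}.Finite) (g : G) (F : Lp ℂ 2 μ) :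
    Lp ℂ 2 μ :=
  (memLp_parity_mul hc hfin g F).toLp _

variable (hc : Measurable c) (hfin : ∀ᵐ x ∂μ, ∀ g : G, {i | c (g • x) i ≠ c x i}.Finite)

theorem coeFn_parityOp (g : G) (F : Lp ℂ 2 μ) :
    parityOp hc hfin g F =ᵐ[μ] fun x => parity (c x) (c (g⁻¹ • x)) * F (g⁻¹ • x) :=
  MemLp.coeFn_toLp _

theorem parityOp_one (F : Lp ℂ 2 μ) : parityOp hc hfin 1 F = F := by
  refine Lp.ext ?_
  filter_upwards [coeFn_parityOp hc hfin 1 F] with x hx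
  simpa using hx

theorem parityOp_mul (g h : G) (F : Lp ℂ 2 μ) :
    parityOp hc hfin (g * h) F = parityOp hc hfin g (parityOp hc hfin h F) := by
  refine Lp.ext ?_
  filter_upwards [coeFn_parityOp hc hfin (g * h) F, coeFn_parityOp hc hfin g (parityOp hc hfin h F),
    (measurePreserving_smul g⁻¹ μ).quasiMeasurePreserving.ae (coeFn_parityOp hc hfin h F),
    (measurePreserving_smul g⁻¹ μ).quasiMeasurePreserving.ae hfin, hfin] with x h1 h2 h3 h4 h5
  rw [h1, h2, h3, ← mul_assoc, parity_mul_parity]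
  · simp [mul_smul]
  · simpa only [ne_comm] using h5 g⁻¹
  · simpa only [ne_comm] using h4 h⁻¹

theorem parityOp_add (g : G) (F F' : Lp ℂ 2 μ) :
    parityOp hc hfin g (F + F') = parityOp hc hfin g F + parityOp hc hfin g F' := by
  refine Lp.ext ?_
  filter_upwards [coeFn_parityOp hc hfin g (F + F'), coeFn_parityOp hc hfin g F,
    coeFn_parityOp hc hfin g F', Lp.coeFn_add (parityOp hc hfin g F) (parityOp hc hfin g F'),
    (measurePreserving_smul g⁻¹ μ).quasiMeasurePreserving.ae (Lp.coeFn_add F F')]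
    with x h1 h2 h3 h4 h5
  rw [h1, h4, Pi.add_apply, h2, h3, h5, Pi.add_apply, mul_add]

theorem parityOp_smul (g : G) (z : ℂ) (F : Lp ℂ 2 μ) :
    parityOp hc hfin g (z • F) = z • parityOp hc hfin g F := by
  refine Lp.ext ?_
  filter_upwards [coeFn_parityOp hc hfin g (z • F), coeFn_parityOp hc hfin g F,
    Lp.coeFn_smul z (parityOp hc hfin g F),
    (measurePreserving_smul g⁻¹ μ).quasiMeasurePreserving.ae (Lp.coeFn_smul z F)]
    with x h1 h2 h3 h4
  rw [h1, h3, Pi.smul_apply, h2, h4, Pi.smul_apply, smul_eq_mul, smul_eq_mul, mul_left_comm]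

theorem norm_parityOp (g : G) (F : Lp ℂ 2 μ) : ‖parityOp hc hfin g F‖ = ‖F‖ := by
  have h : eLpNorm (fun x => parity (c x) (c (g⁻¹ • x)) * F (g⁻¹ • x)) 2 μ = eLpNorm F 2 μ := by
    rw [← eLpNorm_comp_measurePreserving (Lp.memLp F).1 (measurePreserving_smul g⁻¹ μ)]
    exact eLpNorm_congr_norm_ae (Eventually.of_forall fun x => by
      rw [norm_mul, norm_parity, one_mul, Function.comp_apply])
  rw [parityOp, Lp.norm_toLp, h, Lp.norm_def]

/-- The parity representation of `G` on `L²(X, μ)`: the Koopman representation twisted by the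
pull-back under `c` of the parity cocycle. -/
noncomputable def parityRep : G →* (Lp ℂ 2 μ ≃ₗᵢ[ℂ] Lp ℂ 2 μ) where
  toFun g :=
    { toFun := parityOp hc hfin g
      invFun := parityOp hc hfin g⁻¹
      map_add' := parityOp_add hc hfin g
      map_smul' := parityOp_smul hc hfin g
      left_inv := fun F => by rw [← parityOp_mul, inv_mul_cancel, parityOp_one]
      right_inv := fun F => by rw [← parityOp_mul, mul_inv_cancel, parityOp_one]
      norm_map' := norm_parityOp hc hfin g }
  map_one' := LinearIsometryEquiv.ext (parityOp_one hc hfin)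
  map_mul' g h := LinearIsometryEquiv.ext (parityOp_mul hc hfin g h)

theorem parityRep_apply (g : G) (F : Lp ℂ 2 μ) : parityRep hc hfin g F = parityOp hc hfin g F := rfl

/-- The partial products `signProd k ∘ c` are almost invariant: `g` moves `signProd k ∘ c` only on
the set of points `x` such that `c x` and `c (g⁻¹ • x)` differ at or after `k`. -/
theorem hasAlmostInvariantVectors_parityRep [IsProbabilityMeasure μ] :
    HasAlmostInvariantVectors (parityRep hc hfin) := by
  intro S ε hε
  have hmem : ∀ k, MemLp (fun x => signProd k (c x)) 2 μ := fun k =>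
    MemLp.of_bound ((measurable_signProd k).comp hc).aestronglyMeasurable 1
      (Eventually.of_forall fun x => (norm_signProd k _).le)
  let D : G → ℕ → Set X := fun g k => ⋃ i ≥ k, {x | c x i ≠ c (g⁻¹ • x) i}
  have hDm : ∀ g k, MeasurableSet (D g k) := fun g k => by
    refine .biUnion (Set.to_countable _) fun i _ => (measurableSet_eq_fun ?_ ?_).compl
    · exact (measurable_pi_apply i).comp hc
    · exact (measurable_pi_apply i).comp (hc.comp (measurable_const_smul g⁻¹))
  have hD : ∀ g, Tendsto (fun k => μ (D g k)) atTop (𝓝 0) := fun g => by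
    have h0 : μ (⋂ k, D g k) = 0 := by
      refine measure_eq_zero_iff_ae_notMem.2 ?_
      filter_upwards [hfin] with x hx hmem
      obtain ⟨k, hk⟩ := exists_forall_eq_of_finite (hx g⁻¹)
      have := Set.mem_iInter.1 hmem k
      simp only [D, Set.mem_iUnion, Set.mem_ofPred_eq] at this
      obtain ⟨i, hi, hne⟩ := this
      exact hne (hk i hi).symm
    rw [← h0]
    exact tendsto_measure_iInter_atTop (fun k => (hDm g k).nullMeasurableSet)
      (fun k l hkl => Set.biUnion_subset_biUnion_left fun i hi => le_trans hkl hi)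
      ⟨0, measure_ne_top _ _⟩
  have hbound : ∀ g k, ‖parityRep hc hfin g ((hmem k).toLp _) - (hmem k).toLp _‖ ≤
      2 * (μ.real (D g k)) ^ (1 / 2 : ℝ) := fun g k => by
    have hI : MemLp ((D g k).indicator fun _ => (2 : ℂ)) 2 μ :=
      memLp_indicator_const 2 (hDm g k) 2 (Or.inr (measure_ne_top _ _))
    have hle : ‖parityRep hc hfin g ((hmem k).toLp _) - (hmem k).toLp _‖ ≤
        ‖indicatorConstLp 2 (hDm g k) (measure_ne_top μ _) (2 : ℂ)‖ := by
      refine Lp.norm_le_norm_of_ae_le ?_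
      filter_upwards [coeFn_parityOp hc hfin g ((hmem k).toLp _), (hmem k).coeFn_toLp,
        (measurePreserving_smul g⁻¹ μ).quasiMeasurePreserving.ae (hmem k).coeFn_toLp,
        Lp.coeFn_sub (parityRep hc hfin g ((hmem k).toLp _)) ((hmem k).toLp _),
        indicatorConstLp_coeFn (p := 2) (hs := hDm g k) (hμs := measure_ne_top μ _) (c := (2 : ℂ))]
        with x h1 h2 h3 h4 h5
      rw [h4, h5, Pi.sub_apply, parityRep_apply, h1, h2, h3]
      by_cases hx : x ∈ D g k
      · rw [Set.indicator_of_mem hx]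
        refine (norm_sub_le _ _).trans ?_
        rw [norm_mul, norm_parity, norm_signProd, norm_signProd]
        norm_num
      · have hag : ∀ i, k ≤ i → c x i = c (g⁻¹ • x) i := fun i hi => by
          by_contra hne
          exact hx (Set.mem_biUnion (show i ∈ {i | i ≥ k} from hi) hne)
        rw [parity_eq_signProd_mul hag, mul_assoc, signProd_mul_self, mul_one, sub_self]
        simp
    refine hle.trans_eq ?_
    rw [norm_indicatorConstLp (by norm_num) (by norm_num)]
    norm_num
  have hlim : ∀ g, Tendsto (fun k => 2 * (μ.real (D g k)) ^ (1 / 2 : ℝ)) atTop (𝓝 0) := fun g => by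
    have h1 : Tendsto (fun k => μ.real (D g k)) atTop (𝓝 0) :=
      tendsto_measureReal_zero (hD g)
    have h2 := (h1.rpow_const (p := 1 / 2) (Or.inr (by norm_num))).const_mul 2
    simpa using h2
  obtain ⟨k, hk⟩ := ((S.eventually_all).2 fun g _ =>
    (hlim g).eventually (gt_mem_nhds hε)).exists
  refine ⟨(hmem k).toLp _, ?_, fun g hg => (hbound g k).trans_lt (hk g hg)⟩
  rw [Lp.norm_toLp, eLpNorm_congr_norm_ae (g := fun _ => (1 : ℂ))
    (Eventually.of_forall fun x => by rw [norm_signProd, norm_one])]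
  rw [eLpNorm_const _ (by norm_num) (IsProbabilityMeasure.ne_zero μ)]
  simp

end Representation

/-! ### Invariant vectors of the parity representation -/

section Invariant

variable {G : Type u} [Group G] [Countable G] {X : Type v} [MeasurableSpace X]
  [StandardBorelSpace X] [MulAction G X] [MeasurableConstSMul G X] {μ : Measure X}
  [IsProbabilityMeasure μ] [SMulInvariantMeasure G X μ] {c : X → ℕ → Bool} {T : ℕ → X → X}

omit [StandardBorelSpace X] [IsProbabilityMeasure μ] in
theorem ae_forall_apply_smul_of_parityRep_eq (hc : Measurable c)
    (hfin : ∀ᵐ x ∂μ, ∀ g : G, {i | c (g • x) i ≠ c x i}.Finite) {A : Subgroup G} {η : Lp ℂ 2 μ}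
    (hη : ∀ a ∈ A, parityRep hc hfin a η = η) :
    ∀ᵐ x ∂μ, ∀ a ∈ A, η (a • x) = parity (c (a • x)) (c x) * η x := by
  rw [ae_all_iff]
  intro a
  by_cases ha : a ∈ A
  · have h := coeFn_parityOp hc hfin a η
    rw [← parityRep_apply, hη a ha] at h
    filter_upwards [(measurePreserving_smul a μ).quasiMeasurePreserving.ae h] with x hx _
    simpa only [inv_smul_smul] using hx
  · exact Eventually.of_forall fun x hx => absurd hx ha

/-- If `T n x ∈ A • x` for most `x`, then the parity representation has no nonzero `A`-invariant
vector `η`: as `T n` flips one coordinate, `η (T n x) = -η x` for most `x`, while `T n`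
asymptotically fixes the inverse images under `η` of the four open coordinate half planes. -/
theorem IsCentralFlip.eq_zero_of_parityRep_eq (h : IsCentralFlip G μ c T) {A : Subgroup G}
    {l : Filter ℕ} [l.NeBot] (hl : l ≤ atTop)
    (hA : Tendsto (fun n => μ.real {x | ∃ g ∈ (A : Set G), T n x = g • x}) l (𝓝 1))
    {η : Lp ℂ 2 μ}
    (hη : ∀ a ∈ A, parityRep h.measurable_coord h.finite_coord_ne a η = η) : η = 0 := by
  let B : ℕ → Set X := fun k => {x | 0 < (Complex.I ^ k * η x).re}
  have hB : ∀ k, MeasurableSet (B k) := fun k => measurableSet_lt measurable_const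
    (Complex.measurable_re.comp ((Lp.stronglyMeasurable η).measurable.const_mul _))
  -- the four open half planes cover `ℂ \ {0}`
  have hcover : {x | η x ≠ 0} ⊆ ⋃ k, B k := by
    intro x hx
    by_contra hc
    simp only [B, Set.mem_iUnion, Set.mem_ofPred_eq, not_exists, not_lt] at hc
    have h0 := hc 0
    have h1 := hc 1
    have h2 := hc 2
    have h3 := hc 3
    simp [Complex.I_pow_three] at h0 h1 h2 h3
    exact hx (Complex.ext (le_antisymm h0 h2) (le_antisymm h3 h1))
  set E : ℕ → Set X := fun n => (⋃ k, B k) \ ⋃ k, B k ∩ T n ⁻¹' B k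
  have hE : Tendsto (fun n => μ.real (E n)) atTop (𝓝 0) :=
    tendsto_measureReal_zero
      (tendsto_measure_iUnion_diff_iUnion_inter hB fun k => h.tendsto_diff _ (hB k))
  have hle : ∀ n, μ.real {x | η x ≠ 0} ≤
      μ.real (E n) + (1 - μ.real {x | ∃ g ∈ (A : Set G), T n x = g • x}) := by
    intro n
    rw [← probReal_compl_eq_one_sub (h.measurableSet_exists_eq_smul n A)]
    refine le_trans (ENNReal.toReal_mono (measure_ne_top _ _) (measure_mono_ae ?_))
      (measureReal_union_le _ _)
    filter_upwards [ae_forall_apply_smul_of_parityRep_eq h.measurable_coord h.finite_coord_ne hη,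
      h.coord_apply n] with x hx hcx hx0
    by_contra hc
    obtain ⟨hxE, hxA⟩ := not_or.1 hc
    obtain ⟨a, ha, hTx⟩ := not_not.1 hxA
    have hneg : η (T n x) = -η x := by
      have := hx a ha
      rw [← hTx, hcx, parity_flipCoords_singleton] at this
      rw [this, neg_one_mul]
    have hmem : x ∈ ⋃ k, B k ∩ T n ⁻¹' B k := by
      by_contra hn
      exact hxE ⟨hcover hx0, hn⟩
    obtain ⟨k, hk1, hk2⟩ := Set.mem_iUnion.1 hmem
    have hk1' : 0 < (Complex.I ^ k * η x).re := hk1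
    have hk2' : 0 < (Complex.I ^ k * η (T n x)).re := hk2
    rw [hneg, mul_neg, Complex.neg_re] at hk2'
    linarith
  have hlim := (hE.mono_left hl).add (hA.const_sub 1)
  rw [sub_self, add_zero] at hlim
  have h0 : μ.real {x | η x ≠ 0} = 0 :=
    le_antisymm (ge_of_tendsto' hlim hle) measureReal_nonneg
  refine (Lp.eq_zero_iff_ae_eq_zero).2 ?_
  exact (measureReal_eq_zero_iff).1 h0

end Invariant

end StableGroup

theorem proposition3p7 {G : Type u} [Group G] [Countable G] (A : Subgroup G)
    (hmean : ∀ m : Set G → ℝ, StableGroup.IsMean m → StableGroup.IsDiffuse m →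
      StableGroup.IsConjInvariant m → m (A : Set G) = 1)
    (hT : StableGroup.PairHasPropertyT A) :
    ¬ StableGroup.IsStable G := by
  rintro ⟨X, _, _, _, _, μ, _, _, hfree, hstable⟩
  obtain ⟨c, T, h⟩ := hstable.exists_isCentralFlip
  obtain ⟨m, hm, hdiff, hconj, hlim⟩ := h.exists_mean hfree
  have hA := hlim A
  rw [hmean m hm hdiff hconj] at hA
  obtain ⟨η, hη0, hη⟩ := hT (Lp ℂ 2 μ) (StableGroup.parityRep h.measurable_coord h.finite_coord_ne)
    (StableGroup.hasAlmostInvariantVectors_parityRep _ _)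
  exact hη0 (h.eq_zero_of_parityRep_eq Nat.hyperfilter_le_atTop hA hη)
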